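/- Let $J$ be the infinite jet space with coordinates $x=(x^1,\dots,x^n)$ and $u_J$ ($J$ ranging over all multi-indices, $u_\emptyset=u$), for one dependent variable $u$, and let $U\subseteq J$ be open. A differential function on $U$ is a smooth real function on $U$ of $x$ and of the derivatives of $u$ up to some finite order. Write $D_i=\partial_{x^i}+\sum_J u_{J,i}\,\partial_{u_J}$ for the total derivatives, $D_J$ for their iterates, and, for differential functions $f,P,Q,L$, $$f'(P)=\sum_J \frac{\partial f}{\partial u_J}\,D_JP,\qquad f'^{*}(Q)=\sum_J(-1)^{|J|}D_J\Big(\frac{\partial f}{\partial u_J}\,Q\Big),\qquad E_u(L)=\sum_J(-1)^{|J|}D_J\Big(\frac{\partial L}{\partial u_J}\Big).$$ Let $G$ be a differential function on $U$, and let $\mathcal E\subseteq U$ be the set of formal solutions of the PDE $G=0$, that is, the points of $U$ at which $D_JG=0$ for all $J$ (including $G=0$ itself). A differential function $P$ is a symmetry (in characteristic form) of $G=0$ if $G'(P)|_{\mathcal E}=0$; a differential function $Q$ is an adjoint-symmetry of $G=0$ if $G'^{*}(Q)|_{\mathcal E}=0$. The equation $G=0$ is Euler--Lagrange if $G=E_u(L)$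 on $U$ for some differential function $L$ on $U$. A variational integrating factor of $G$ is a differential function $W\not\equiv0$ on $U$ such that $WG=E_u(L)$ on $U$ for some differential function $L$ on $U$. Suppose that $G=0$ admits a variational integrating factor $W$. Then: 1. For every symmetry $P$ of $G=0$, the product $WP$ is an adjoint-symmetry of $G=0$. 2. If moreover $G=0$ is Euler--Lagrange, then for every symmetry $P$ of $G=0$ all the functions $W^lP$, $l=0,1,2,\dots$, are symmetries of $G=0$. Thus $W$ is a multiplicative recursion operator for symmetries: multiplication by $W$ is a linear differential operator in total derivatives (of order zero, with a differential function as coefficient) that maps symmetries of $G=0$ to symmetries of $G=0$. -/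

import Mathlib

open scoped ContDiff

/-- Infinite jet space `J = (x, u, ∂u, ∂²u, …)` of one dependent variable `u` and `n` independent
variables. A point is `z = (z.1, z.2)`, where `z.1 i` is the value of the coordinate `x^i` and
`z.2 J` is the value of the coordinate `u_J`, for a multi-index `J : Fin n → ℕ`
(differentiate `J i` times with respect to `x^i`); in particular `z.2 0` is the value of `u`.
The topology is the product topology, that is, the inverse limit topology of the finite-order
jet spaces. -/
abbrev Jet (n : ℕ) : Type := (Fin n → ℝ) × ((Fin n → ℕ) → ℝ)

/-- The projection of jet space on the coordinates `x^i` and the finitely many coordinates `u_J`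
with `J ∈ S`. -/
def jetProj {n : ℕ} (S : Finset (Fin n → ℕ)) (z : Jet n) : (Fin n → ℝ) × (S → ℝ) :=
  (z.1, fun J => z.2 J)

/-- `f` is a differential function on the open set `U` of jet space: on `U` it is a smooth function
of `x` and of finitely many of the jet coordinates `u_J` (equivalently, of `x` and of the
derivatives of `u` up to some finite order). The values of `f` off `U` play no role. -/
def IsDifferentialFunction {n : ℕ} (U : Set (Jet n)) (f : Jet n → ℝ) : Prop :=
  ∃ (S : Finset (Fin n → ℕ)) (F : (Fin n → ℝ) × (S → ℝ) → ℝ),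
    ContDiffOn ℝ ∞ F (jetProj S '' U) ∧ ∀ z ∈ U, f z = F (jetProj S z)

/-- The partial derivative `∂f/∂x^i` on jet space (all `u_J` being held fixed). -/
noncomputable def partialX {n : ℕ} (i : Fin n) (f : Jet n → ℝ) : Jet n → ℝ :=
  fun z => deriv (fun t : ℝ => f (Function.update z.1 i t, z.2)) (z.1 i)

/-- The partial derivative `∂f/∂u_J` on jet space. -/
noncomputable def partialU {n : ℕ} (J : Fin n → ℕ) (f : Jet n → ℝ) : Jet n → ℝ :=
  fun z => deriv (fun t : ℝ => f (z.1, Function.update z.2 J t)) (z.2 J)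

/-- The total derivative `D_i f = ∂f/∂x^i + ∑_J u_{J,i} ∂f/∂u_J`. For a differential function
only finitely many terms are nonzero. -/
noncomputable def totalD {n : ℕ} (i : Fin n) (f : Jet n → ℝ) : Jet n → ℝ :=
  fun z => partialX i f z + ∑ᶠ J : Fin n → ℕ, z.2 (J + Pi.single i 1) * partialU J f z

/-- The iterated total derivative `D_J = D_1^{J_1} ⋯ D_n^{J_n}`. -/
noncomputable def totalDIter {n : ℕ} (J : Fin n → ℕ) (f : Jet n → ℝ) : Jet n → ℝ :=
  (List.finRange n).foldr (fun i g => (totalD i)^[J i] g) f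

/-- The Frechet derivative `f'(P) = ∑_J (∂f/∂u_J) D_J P`, which is also `pr X_P (f)`, the action
on `f` of the prolongation of the vector field `X_P = P ∂_u`. -/
noncomputable def frechet {n : ℕ} (f P : Jet n → ℝ) : Jet n → ℝ :=
  fun z => ∑ᶠ J : Fin n → ℕ, partialU J f z * totalDIter J P z

/-- The adjoint of the Frechet derivative, `f'^*(Q) = ∑_J (-1)^|J| D_J ((∂f/∂u_J) Q)`. -/
noncomputable def frechetAdjoint {n : ℕ} (f Q : Jet n → ℝ) : Jet n → ℝ :=
  fun z => ∑ᶠ J : Fin n → ℕ, (-1 : ℝ) ^ (∑ i, J i) * totalDIter J (partialU J f * Q) z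

/-- The Euler--Lagrange operator `E_u(L) = ∑_J (-1)^|J| D_J (∂L/∂u_J)`. -/
noncomputable def eulerOperator {n : ℕ} (L : Jet n → ℝ) : Jet n → ℝ :=
  fun z => ∑ᶠ J : Fin n → ℕ, (-1 : ℝ) ^ (∑ i, J i) * totalDIter J (partialU J L) z

/-- The space of formal solutions of `G = 0` in `U`: the points of jet space (that is, formal power
series `u(x)` at a base point) at which `G` and all its total derivatives vanish. -/
def formalSolutions {n : ℕ} (U : Set (Jet n)) (G : Jet n → ℝ) : Set (Jet n) :=
  {z | z ∈ U ∧ ∀ J : Fin n → ℕ, totalDIter J G z = 0}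

/-- `P` is the characteristic function of a symmetry `P ∂_u` of `G = 0`. -/
def IsSymmetry {n : ℕ} (U : Set (Jet n)) (G P : Jet n → ℝ) : Prop :=
  IsDifferentialFunction U P ∧ ∀ z ∈ formalSolutions U G, frechet G P z = 0

/-- `Q` is an adjoint-symmetry of `G = 0`. -/
def IsAdjointSymmetry {n : ℕ} (U : Set (Jet n)) (G Q : Jet n → ℝ) : Prop :=
  IsDifferentialFunction U Q ∧ ∀ z ∈ formalSolutions U G, frechetAdjoint G Q z = 0

/-- `G = 0` is an Euler--Lagrange equation: `G = E_u(L)` for some Lagrangian `L`. -/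
def IsEulerLagrange {n : ℕ} (U : Set (Jet n)) (G : Jet n → ℝ) : Prop :=
  ∃ L : Jet n → ℝ, IsDifferentialFunction U L ∧ ∀ z ∈ U, eulerOperator L z = G z

/-- `W` is a variational integrating factor of `G`: a differential function, not identically zero,
such that `W G = E_u(L)` for some Lagrangian `L`. -/
def IsVariationalIntegratingFactor {n : ℕ} (U : Set (Jet n)) (G W : Jet n → ℝ) : Prop :=
  IsDifferentialFunction U W ∧ (∃ z ∈ U, W z ≠ 0) ∧ IsEulerLagrange U (W * G)

/-- `R` is a recursion operator for symmetries of `G = 0`: a linear differential operator in total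
derivatives `R = ∑_J a_J D_J` (a finite sum, with differential functions `a_J` as coefficients)
that maps symmetries to symmetries. -/
def IsRecursionOperator {n : ℕ} (U : Set (Jet n)) (G : Jet n → ℝ)
    (R : (Jet n → ℝ) → (Jet n → ℝ)) : Prop :=
  (∃ (S : Finset (Fin n → ℕ)) (a : (Fin n → ℕ) → Jet n → ℝ),
    (∀ J ∈ S, IsDifferentialFunction U (a J)) ∧
    ∀ P, IsDifferentialFunction U P → ∀ z ∈ U, R P z = ∑ J ∈ S, a J z * totalDIter J P z) ∧
  ∀ P, IsSymmetry U G P → IsSymmetry U G (R P)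

open TopologicalSpace

/-! The linearization of an Euler–Lagrange expression is formally self-adjoint
(`linearization_euler`). Apply this to `W G = E_u(L)` and expand both sides by the product rule: `W
G'(P) + G W'(P) = G'^*(W P) + W'^*(G P)`. At a formal solution `G'(P) = 0` and `G = 0`, while
`W'^*(G P)` is a sum of total derivatives of multiples of `G`, hence zero. So `G'^*(W P) = 0`. If
`G` is itself Euler–Lagrange, then `G' = G'^*`, so `W P` is again a symmetry, and this iterates.

The calculus takes place in an abstract `JetAlgebra`, where `D_i` is a derivation and finite
supports control every sum. Differential functions on `U` form such an algebra, and `Restricts`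
carries the pointwise definitions into it. -/

/-! ### Differential functions and their directional derivatives. -/

/-- Filling in the missing coordinates from a fixed `z ∈ U` gives a continuous section through `z`.
Openness lets `fderiv` be used on representatives. -/
theorem isOpen_image_jetProj {n : ℕ} (S : Finset (Fin n → ℕ)) {U : Set (Jet n)}
    (hU : IsOpen U) : IsOpen (jetProj S '' U) := by
  classical
  rw [isOpen_iff_mem_nhds]
  rintro _ ⟨z, hz, rfl⟩
  let s : (Fin n → ℝ) × (S → ℝ) → Jet n :=
    fun p => (p.1, fun J => if h : J ∈ S then p.2 ⟨J, h⟩ else z.2 J)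
  have hs : Continuous s := by
    refine continuous_fst.prodMk (continuous_pi fun J => ?_)
    by_cases h : J ∈ S
    · simp only [h, dite_true]
      fun_prop
    · simpa [h] using continuous_const
  have hsz : s (jetProj S z) = z := by
    ext J
    · rfl
    · simp [s, jetProj]
  have hps : ∀ p, jetProj S (s p) = p := fun p => by
    ext J
    · rfl
    · simp [s, jetProj]
  filter_upwards [(hU.preimage hs).mem_nhds (show s (jetProj S z) ∈ U by rwa [hsz])] with p hp
  exact ⟨s p, hp, hps p⟩

theorem IsDifferentialFunction.exists_enlarge {n : ℕ} {U : Set (Jet n)}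
    {S T : Finset (Fin n → ℕ)} (hST : S ⊆ T) {f : Jet n → ℝ}
    {F : (Fin n → ℝ) × (S → ℝ) → ℝ} (hF : ContDiffOn ℝ ∞ F (jetProj S '' U))
    (hf : ∀ z ∈ U, f z = F (jetProj S z)) :
    ∃ F' : (Fin n → ℝ) × (T → ℝ) → ℝ,
      ContDiffOn ℝ ∞ F' (jetProj T '' U) ∧ ∀ z ∈ U, f z = F' (jetProj T z) := by
  let r : (Fin n → ℝ) × (T → ℝ) → (Fin n → ℝ) × (S → ℝ) :=
    fun p => (p.1, fun J => p.2 ⟨J, hST J.2⟩)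
  have hr : ContDiff ℝ ∞ r := by
    refine contDiff_fst.prodMk (contDiff_pi.2 fun J => ?_)
    exact (contDiff_apply ℝ ℝ (⟨J, hST J.2⟩ : T)).comp contDiff_snd
  refine ⟨F ∘ r, hF.comp hr.contDiffOn ?_, fun z hz => hf z hz⟩
  rintro _ ⟨z, hz, rfl⟩
  exact ⟨z, hz, rfl⟩

theorem IsDifferentialFunction.exists_common {n : ℕ} {U : Set (Jet n)} {f g : Jet n → ℝ}
    (hf : IsDifferentialFunction U f) (hg : IsDifferentialFunction U g) :
    ∃ (S : Finset (Fin n → ℕ)) (F G : (Fin n → ℝ) × (S → ℝ) → ℝ),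
      ContDiffOn ℝ ∞ F (jetProj S '' U) ∧ ContDiffOn ℝ ∞ G (jetProj S '' U) ∧
      (∀ z ∈ U, f z = F (jetProj S z)) ∧ ∀ z ∈ U, g z = G (jetProj S z) := by
  classical
  obtain ⟨S, F, hF, hf⟩ := hf
  obtain ⟨T, G, hG, hg⟩ := hg
  obtain ⟨F', hF', hf'⟩ := exists_enlarge (Finset.subset_union_left (s₂ := T)) hF hf
  obtain ⟨G', hG', hg'⟩ := exists_enlarge (Finset.subset_union_right (s₁ := S)) hG hg
  exact ⟨_, F', G', hF', hG', hf', hg'⟩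

theorem IsDifferentialFunction.congr {n : ℕ} {U : Set (Jet n)} {f g : Jet n → ℝ}
    (hf : IsDifferentialFunction U f) (h : ∀ z ∈ U, g z = f z) : IsDifferentialFunction U g := by
  obtain ⟨S, F, hF, hf⟩ := hf
  exact ⟨S, F, hF, fun z hz => (h z hz).trans (hf z hz)⟩

theorem IsDifferentialFunction.add {n : ℕ} {U : Set (Jet n)} {f g : Jet n → ℝ}
    (hf : IsDifferentialFunction U f) (hg : IsDifferentialFunction U g) :
    IsDifferentialFunction U (f + g) := by
  obtain ⟨S, F, G, hF, hG, hf, hg⟩ := hf.exists_common hg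
  exact ⟨S, F + G, hF.add hG, fun z hz => by simp [hf z hz, hg z hz]⟩

theorem IsDifferentialFunction.mul {n : ℕ} {U : Set (Jet n)} {f g : Jet n → ℝ}
    (hf : IsDifferentialFunction U f) (hg : IsDifferentialFunction U g) :
    IsDifferentialFunction U (f * g) := by
  obtain ⟨S, F, G, hF, hG, hf, hg⟩ := hf.exists_common hg
  exact ⟨S, F * G, hF.mul hG, fun z hz => by simp [hf z hz, hg z hz]⟩

theorem IsDifferentialFunction.const {n : ℕ} (U : Set (Jet n)) (c : ℝ) :
    IsDifferentialFunction U fun _ => c :=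
  ⟨∅, fun _ => c, contDiffOn_const, fun _ _ => rfl⟩

theorem IsDifferentialFunction.coordU {n : ℕ} (U : Set (Jet n)) (J : Fin n → ℕ) :
    IsDifferentialFunction U fun z => z.2 J :=
  ⟨{J}, fun p => p.2 ⟨J, Finset.mem_singleton_self J⟩,
    ((contDiff_apply ℝ ℝ (⟨J, Finset.mem_singleton_self J⟩ : ({J} : Finset _))).comp
      contDiff_snd).contDiffOn, fun _ _ => rfl⟩

/-- On an open set, the derivative of a differential function along a line can be computed from a
representative on a finite-dimensional space. -/
theorem hasLineDerivAt_of_representative {n : ℕ} {U : Set (Jet n)} (hU : IsOpen U)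
    {S : Finset (Fin n → ℕ)} {f : Jet n → ℝ} {F : (Fin n → ℝ) × (S → ℝ) → ℝ}
    (hF : ContDiffOn ℝ ∞ F (jetProj S '' U)) (hf : ∀ z ∈ U, f z = F (jetProj S z))
    (w : Jet n) {z : Jet n} (hz : z ∈ U) :
    HasLineDerivAt ℝ f (fderiv ℝ F (jetProj S z) (jetProj S w)) z w := by
  have hd : HasFDerivAt F (fderiv ℝ F (jetProj S z)) (jetProj S z) :=
    ((hF.contDiffAt ((isOpen_image_jetProj S hU).mem_nhds ⟨z, hz, rfl⟩)).differentiableAt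
      (by simp)).hasFDerivAt
  have hl : HasDerivAt (fun t : ℝ => F (jetProj S z + t • jetProj S w))
    (fderiv ℝ F (jetProj S z) (jetProj S w)) 0 := hd.hasLineDerivAt (jetProj S w)
  have hc : Continuous fun t : ℝ => z + t • w := by fun_prop
  refine hl.congr_of_eventuallyEq ?_
  filter_upwards [(hU.preimage hc).mem_nhds (show z + (0 : ℝ) • w ∈ U by simpa)] with t ht
  exact hf _ ht

theorem IsDifferentialFunction.lineDifferentiableAt {n : ℕ} {U : Set (Jet n)} (hU : IsOpen U)
    {f : Jet n → ℝ} (hf : IsDifferentialFunction U f) (w : Jet n) {z : Jet n} (hz : z ∈ U) :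
    LineDifferentiableAt ℝ f z w := by
  obtain ⟨S, F, hF, hf⟩ := hf
  exact (hasLineDerivAt_of_representative hU hF hf w hz).lineDifferentiableAt

theorem contDiffOn_fderiv_apply {n : ℕ} {U : Set (Jet n)} (hU : IsOpen U)
    {S : Finset (Fin n → ℕ)} {F : (Fin n → ℝ) × (S → ℝ) → ℝ}
    (hF : ContDiffOn ℝ ∞ F (jetProj S '' U)) (v : (Fin n → ℝ) × (S → ℝ)) :
    ContDiffOn ℝ ∞ (fun p => fderiv ℝ F p v) (jetProj S '' U) :=
  (hF.fderiv_of_isOpen (isOpen_image_jetProj S hU) (by simp)).clm_apply contDiffOn_const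

theorem IsDifferentialFunction.dirDeriv {n : ℕ} {U : Set (Jet n)} (hU : IsOpen U)
    {f : Jet n → ℝ} (hf : IsDifferentialFunction U f) (w : Jet n) :
    IsDifferentialFunction U fun z => lineDeriv ℝ f z w := by
  obtain ⟨S, F, hF, hf⟩ := hf
  exact ⟨S, _, contDiffOn_fderiv_apply hU hF (jetProj S w),
    fun z hz => (hasLineDerivAt_of_representative hU hF hf w hz).lineDeriv⟩

theorem IsDifferentialFunction.lineDeriv_comm {n : ℕ} {U : Set (Jet n)} (hU : IsOpen U)
    {f : Jet n → ℝ} (hf : IsDifferentialFunction U f) (v w : Jet n) {z : Jet n} (hz : z ∈ U) :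
    lineDeriv ℝ (fun y => lineDeriv ℝ f y v) z w = lineDeriv ℝ (fun y => lineDeriv ℝ f y w) z v := by
  obtain ⟨S, F, hF, hf⟩ := hf
  have hFz : ContDiffAt ℝ ∞ F (jetProj S z) :=
    hF.contDiffAt ((isOpen_image_jetProj S hU).mem_nhds ⟨z, hz, rfl⟩)
  have key : ∀ v w : Jet n, lineDeriv ℝ (fun y => lineDeriv ℝ f y v) z w =
      fderiv ℝ (fderiv ℝ F) (jetProj S z) (jetProj S w) (jetProj S v) := fun v w => by
    rw [(hasLineDerivAt_of_representative hU (contDiffOn_fderiv_apply hU hF (jetProj S v))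
      (fun y hy => (hasLineDerivAt_of_representative hU hF hf v hy).lineDeriv) w hz).lineDeriv,
      fderiv_clm_apply ((hFz.fderiv_right (m := 1) (by norm_cast)).differentiableAt (by simp))
        (differentiableAt_const _)]
    simp
  rw [key, key]
  exact (hFz.isSymmSndFDerivAt (by simp only [minSmoothness_of_isRCLikeNormedField]; norm_cast)) _ _

theorem lineDeriv_congr_of_eqOn {n : ℕ} {U : Set (Jet n)} (hU : IsOpen U) {f g : Jet n → ℝ}
    (h : ∀ z ∈ U, f z = g z) (w : Jet n) {z : Jet n} (hz : z ∈ U) :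
    lineDeriv ℝ f z w = lineDeriv ℝ g z w := by
  have hc : Continuous fun t : ℝ => z + t • w := by fun_prop
  refine Filter.EventuallyEq.deriv_eq ?_
  filter_upwards [(hU.preimage hc).mem_nhds (show z + (0 : ℝ) • w ∈ U by simpa)] with t ht
  exact h _ ht

/-- A shift of the parameter, so no differentiability is needed. Both kinds of partial derivative
become derivatives in constant directions. -/
theorem partialX_eq_lineDeriv {n : ℕ} (i : Fin n) (f : Jet n → ℝ) (z : Jet n) :
    partialX i f z = lineDeriv ℝ f z (Pi.single i 1, 0) := by
  have h := deriv_comp_const_add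
    (fun t : ℝ => f (Function.update z.1 i t, z.2)) (z.1 i) 0
  rw [add_zero] at h
  rw [partialX, ← h, lineDeriv]
  congr 1
  ext t
  congr 1
  ext j
  · by_cases hj : j = i
    · subst hj; simp
    · simp [hj]
  · simp

theorem partialU_eq_lineDeriv {n : ℕ} (J : Fin n → ℕ) (f : Jet n → ℝ) (z : Jet n) :
    partialU J f z = lineDeriv ℝ f z (0, Pi.single J 1) := by
  have h := deriv_comp_const_add
    (fun t : ℝ => f (z.1, Function.update z.2 J t)) (z.2 J) 0
  rw [add_zero] at h
  rw [partialU, ← h, lineDeriv]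
  congr 1
  ext t
  congr 1
  ext K
  · simp
  · by_cases hj : K = J
    · subst hj; simp
    · simp [hj]

/-! ### Algebraic calculus: sums over `∂/∂u_J` and total derivatives. -/

/-- The algebraic structure of an algebra of differential functions of one dependent variable `u`
and `n` independent variables: commuting derivations `∂/∂x^i` and `∂/∂u_J`, of which each element
is annihilated by all but finitely many, and the coordinates `u_J`. -/
class JetAlgebra (n : outParam ℕ) (A : Type*) [CommRing A] [Algebra ℝ A] where
  /-- The derivation `∂/∂x^i`. -/
  dX : Fin n → Derivation ℝ A A
  /-- The derivation `∂/∂u_J`. -/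
  dU : (Fin n → ℕ) → Derivation ℝ A A
  /-- The coordinate `u_J`. -/
  uCoord : (Fin n → ℕ) → A
  dX_dX_comm : ∀ (i j : Fin n) (a : A), dX i (dX j a) = dX j (dX i a)
  dU_dX_comm : ∀ (J : Fin n → ℕ) (i : Fin n) (a : A), dU J (dX i a) = dX i (dU J a)
  dU_dU_comm : ∀ (J K : Fin n → ℕ) (a : A), dU J (dU K a) = dU K (dU J a)
  finite_dU_ne_zero : ∀ a : A, {J | dU J a ≠ 0}.Finite
  dX_uCoord : ∀ (i : Fin n) (J : Fin n → ℕ), dX i (uCoord J) = 0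
  dU_uCoord : ∀ K J : Fin n → ℕ, dU K (uCoord J) = if K = J then 1 else 0

namespace JetAlgebra

variable {n : ℕ} {A : Type*} [CommRing A] [Algebra ℝ A] [JetAlgebra n A]

/-- The finite set of the multi-indices `J` for which `a` depends on `u_J`. -/
noncomputable def dSupp (a : A) : Finset (Fin n → ℕ) := (finite_dU_ne_zero a).toFinset

theorem dU_eq_zero {a : A} {J : Fin n → ℕ} (h : J ∉ dSupp a) : dU J a = 0 := by
  by_contra h'
  exact h ((finite_dU_ne_zero a).mem_toFinset.2 h')

theorem dSupp_dU_subset (a : A) (J : Fin n → ℕ) : dSupp (dU J a) ⊆ dSupp a := by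
  intro K hK
  by_contra h
  have : dU K (dU J a) = 0 := by rw [dU_dU_comm, dU_eq_zero h, map_zero]
  exact (finite_dU_ne_zero _).mem_toFinset.1 hK this

/-- The linear map `∑_J Φ_J ∘ ∂/∂u_J`. -/
noncomputable def jetSum (Φ : (Fin n → ℕ) → A →ₗ[ℝ] A) :
    A →ₗ[ℝ] A where
  toFun a := ∑ᶠ J, Φ J (dU J a)
  map_add' a b := by
    simp only [map_add]
    exact finsum_add_distrib
      ((finite_dU_ne_zero a).subset fun J hJ h => hJ (by simp only [h, map_zero]))
      ((finite_dU_ne_zero b).subset fun J hJ h => hJ (by simp only [h, map_zero]))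
  map_smul' c a := by
    have h : (Function.support fun J => Φ J (dU J a)).Finite :=
      (finite_dU_ne_zero a).subset fun J hJ h => hJ (by simp only [h, map_zero])
    simp only [Derivation.map_smul, map_smul, RingHom.id_apply]
    exact (smul_finsum' c h).symm

theorem jetSum_apply (Φ : (Fin n → ℕ) → A →ₗ[ℝ] A) {a : A}
    {S : Finset (Fin n → ℕ)} (hS : dSupp a ⊆ S) : jetSum Φ a = ∑ J ∈ S, Φ J (dU J a) :=
  finsum_eq_sum_of_support_subset _ fun J hJ => by
    by_contra h
    exact hJ (by simp [dU_eq_zero fun h' => h (hS h')])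

theorem dSupp_dX_subset (a : A) (i : Fin n) : dSupp (dX i a) ⊆ dSupp a := by
  intro K hK
  by_contra h
  refine (finite_dU_ne_zero _).mem_toFinset.1 hK ?_
  rw [dU_dX_comm, dU_eq_zero h, map_zero]

/-- The common source of the product rules for `totD`, `linearization` and `adjLinearization`. -/
theorem jetSum_mul (Φ : (Fin n → ℕ) → A →ₗ[ℝ] A) (a b : A) :
    jetSum Φ (a * b) = jetSum (fun J => Φ J ∘ₗ LinearMap.mulLeft ℝ a) b +
      jetSum (fun J => Φ J ∘ₗ LinearMap.mulLeft ℝ b) a := by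
  classical
  rw [jetSum_apply _ (show dSupp a ⊆ dSupp a ∪ dSupp b ∪ dSupp (a * b) by grind),
    jetSum_apply _ (show dSupp b ⊆ dSupp a ∪ dSupp b ∪ dSupp (a * b) by grind),
    jetSum_apply _ (show dSupp (a * b) ⊆ dSupp a ∪ dSupp b ∪ dSupp (a * b) by grind),
    ← Finset.sum_add_distrib]
  refine Finset.sum_congr rfl fun J _ => ?_
  rw [Derivation.leibniz, map_add]
  rfl

theorem jetSum_mulLeft_mul (c : (Fin n → ℕ) → A) (a b : A) :
    jetSum (fun J => LinearMap.mulLeft ℝ (c J)) (a * b) =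
      a * jetSum (fun J => LinearMap.mulLeft ℝ (c J)) b +
      b * jetSum (fun J => LinearMap.mulLeft ℝ (c J)) a := by
  rw [jetSum_mul, jetSum_apply _ (subset_refl (dSupp a)), jetSum_apply _ (subset_refl (dSupp a)),
    jetSum_apply _ (subset_refl (dSupp b)), jetSum_apply _ (subset_refl (dSupp b)),
    Finset.mul_sum, Finset.mul_sum]
  simp only [LinearMap.comp_apply, LinearMap.mulLeft_apply, mul_left_comm]

/-- The total derivative `D_i` as a derivation of the algebra of differential functions. -/
noncomputable def totD (i : Fin n) : Derivation ℝ (A) (A) :=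
  Derivation.mk'
    ((dX i : Derivation ℝ (A) (A)).toLinearMap +
      jetSum fun J => LinearMap.mulLeft ℝ (uCoord (J + Pi.single i 1)))
    fun a b => by
      rw [LinearMap.add_apply, LinearMap.add_apply, LinearMap.add_apply, jetSum_mulLeft_mul]
      exact (congrArg (· + _) ((dX i).leibniz a b)).trans (by simp only [smul_eq_mul]; ring!)

theorem totD_eq (i : Fin n) (a : A) : totD i a =
    dX i a + jetSum (fun J => LinearMap.mulLeft ℝ (uCoord (J + Pi.single i 1))) a := rfl

theorem totD_apply (i : Fin n) {a : A} {S : Finset (Fin n → ℕ)} (hS : dSupp a ⊆ S) :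
    totD i a = dX i a + ∑ J ∈ S, uCoord (J + Pi.single i 1) * dU J a :=
  congrArg (dX i a + ·) (jetSum_apply _ hS)

theorem dSupp_uCoord_subset (J : Fin n → ℕ) : dSupp (uCoord J : A) ⊆ {J} := by
  intro K hK
  by_contra h
  refine (finite_dU_ne_zero _).mem_toFinset.1 hK ?_
  rw [dU_uCoord, if_neg (by simpa using h)]

theorem totD_uCoord (i : Fin n) (J : Fin n → ℕ) :
    totD i (uCoord J : A) = uCoord (J + Pi.single i 1) := by
  rw [totD_apply i (dSupp_uCoord_subset J), dX_uCoord, Finset.sum_singleton, dU_uCoord,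
    if_pos rfl, mul_one, zero_add]

theorem totD_comm (i j : Fin n) (a : A) : totD i (totD j a) = totD j (totD i a) := by
  -- This expansion is symmetric in `i` and `j`, once the partial derivatives commute and the double
  -- sum is reindexed.
  have key : ∀ i j : Fin n, totD i (totD j a) = dX i (dX j a) +
      ∑ J ∈ dSupp a, uCoord (J + Pi.single i 1) * dX j (dU J a) +
      ∑ J ∈ dSupp a, uCoord (J + Pi.single j 1) * dX i (dU J a) +
      ∑ J ∈ dSupp a, ∑ K ∈ dSupp a,
        uCoord (J + Pi.single j 1) * (uCoord (K + Pi.single i 1) * dU K (dU J a)) +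
      ∑ J ∈ dSupp a, dU J a * uCoord (J + Pi.single j 1 + Pi.single i 1) := fun i j => by
    rw [totD_apply j subset_rfl, map_add, map_sum, totD_apply i (dSupp_dX_subset a j)]
    simp only [Derivation.leibniz, smul_eq_mul, totD_uCoord, totD_apply i (dSupp_dU_subset a _),
      mul_add, Finset.sum_add_distrib, Finset.mul_sum, dU_dX_comm]
    ring
  rw [key i j, key j i, dX_dX_comm, Finset.sum_comm]
  have h1 : ∀ J K : Fin n → ℕ,
      uCoord (J + Pi.single j 1) * (uCoord (K + Pi.single i 1) * dU K (dU J a)) =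
      uCoord (K + Pi.single i 1) * (uCoord (J + Pi.single j 1) * dU J (dU K a)) := fun J K => by
    rw [dU_dU_comm J K]; ring
  simp only [h1, add_right_comm _ (Pi.single j 1) (Pi.single i 1)]
  ring

/-- The commutation relation `[∂/∂u_J, D_i] = ∂/∂u_{J - e_i}`. -/
theorem dU_totD (J : Fin n → ℕ) (i : Fin n) {a : A} {S : Finset (Fin n → ℕ)}
    (hS : dSupp a ⊆ S) : dU J (totD i a) =
      totD i (dU J a) + ∑ K ∈ S, if J = K + Pi.single i 1 then dU K a else 0 := by
  rw [totD_apply i hS, totD_apply i ((dSupp_dU_subset a J).trans hS), map_add, map_sum, add_assoc,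
    ← Finset.sum_add_distrib, dU_dX_comm]
  congr 1
  refine Finset.sum_congr rfl fun K _ => ?_
  rw [Derivation.leibniz, dU_uCoord, dU_dU_comm]
  simp only [smul_eq_mul, mul_ite, mul_one, mul_zero]

open Classical in
theorem dSupp_totD_subset (a : A) (i : Fin n) :
    dSupp (totD i a) ⊆ dSupp a ∪ (dSupp a).image (· + Pi.single i 1) := by
  intro J hJ
  by_contra h
  simp only [Finset.mem_union, Finset.mem_image, not_or, not_exists, not_and] at h
  refine (finite_dU_ne_zero _).mem_toFinset.1 hJ ?_
  rw [dU_totD J i subset_rfl, dU_eq_zero h.1, map_zero, zero_add]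
  exact Finset.sum_eq_zero fun K hK => if_neg fun hJK => h.2 K hK hJK.symm

/-- The commutator term `∂/∂u_{J - e_i}` is reindexed by `J = K + e_i`, which avoids subtracting
multi-indices. -/
theorem jetSum_totD (Φ : (Fin n → ℕ) → A →ₗ[ℝ] A) (i : Fin n) (a : A) :
    jetSum Φ (totD i a) = jetSum (fun J => Φ J ∘ₗ (totD i).toLinearMap) a +
      jetSum (fun J => Φ (J + Pi.single i 1)) a := by
  classical
  rw [jetSum_apply _ (dSupp_totD_subset a i), jetSum_apply _ (Finset.subset_union_left
    (s₂ := (dSupp a).image (· + Pi.single i 1))), jetSum_apply _ (subset_refl (dSupp a))]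
  simp only [dU_totD _ i (subset_refl (dSupp a)), map_add, map_sum, Finset.sum_add_distrib]
  congr 1
  rw [Finset.sum_comm]
  refine Finset.sum_congr rfl fun K hK => ?_
  rw [Finset.sum_eq_single (K + Pi.single i 1)]
  · simp
  · intro J _ hJ
    simp [hJ]
  · intro h
    exact absurd (Finset.mem_union_right _ (Finset.mem_image_of_mem _ hK)) h

/-! ### Iterated total derivatives and induction on multi-indices. -/

/-- The iterated total derivative `D_J` as an endomorphism of the algebra of differential
functions. -/
noncomputable def totDIter (J : Fin n → ℕ) : Module.End ℝ (A) :=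
  ((List.finRange n).map fun i => ((totD i).toLinearMap : Module.End ℝ (A)) ^ J i).prod

theorem totDIter_zero (a : A) : totDIter 0 a = a := by
  have : (totDIter 0 : Module.End ℝ (A)) = 1 :=
    List.prod_eq_one fun x hx => by
      obtain ⟨i, -, rfl⟩ := List.mem_map.1 hx
      rfl
  rw [this, Module.End.one_apply]

theorem commute_totD (i j : Fin n) : Commute ((totD i).toLinearMap : Module.End ℝ (A))
    ((totD j).toLinearMap : Module.End ℝ (A)) :=
  LinearMap.ext fun a => totD_comm i j a

theorem totDIter_totD (J : Fin n → ℕ) (i : Fin n) (a : A) :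
    totDIter J (totD i a) = totD i (totDIter J a) := by
  have h : Commute (totDIter J) ((totD i).toLinearMap : Module.End ℝ (A)) :=
    Commute.list_prod_left _ _ fun x hx => by
      obtain ⟨j, -, rfl⟩ := List.mem_map.1 hx
      exact (commute_totD j i).pow_left _
  exact LinearMap.congr_fun h.eq a

theorem totDIter_add_single (J : Fin n → ℕ) (i : Fin n) (a : A) :
    totDIter (J + Pi.single i 1) a = totD i (totDIter J a) := by
  -- Without repetitions, exactly one factor gains a power of `totD i`, and it commutes past the
  -- factors before it.
  have key : ∀ l : List (Fin n), l.Nodup → i ∈ l →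
      (l.map fun k => ((totD k).toLinearMap : Module.End ℝ (A)) ^
        (J + Pi.single i 1 : Fin n → ℕ) k).prod =
      (totD i).toLinearMap * (l.map fun k =>
        ((totD k).toLinearMap : Module.End ℝ (A)) ^ J k).prod := by
    intro l
    induction l with
    | nil => simp
    | cons k l ih =>
      intro hl hi
      obtain ⟨hk, hl⟩ := List.nodup_cons.1 hl
      rw [List.map_cons, List.map_cons, List.prod_cons, List.prod_cons]
      by_cases h : i = k
      · subst h
        have hmap : (l.map fun k => ((totD k).toLinearMap : Module.End ℝ (A)) ^
            (J + Pi.single i 1 : Fin n → ℕ) k) =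
            l.map fun k => ((totD k).toLinearMap : Module.End ℝ (A)) ^ J k :=
          List.map_congr_left fun m hm => by
            have : m ≠ i := fun h => hk (h ▸ hm)
            simp [this]
        rw [hmap, ← mul_assoc, ← pow_succ', Pi.add_apply, Pi.single_eq_same]
      · rw [ih hl ((List.mem_cons.1 hi).resolve_left h), ← mul_assoc, ← mul_assoc,
          ((commute_totD i k).pow_right _).eq, Pi.add_apply, Pi.single_eq_of_ne (Ne.symm h),
          add_zero]
  exact LinearMap.congr_fun (key _ (List.nodup_finRange n) (List.mem_finRange i)) a

theorem multiIndex_induction {p : (Fin n → ℕ) → Prop} (zero : p 0)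
    (add_single : ∀ J i, p J → p (J + Pi.single i 1)) (J : Fin n → ℕ) : p J := by
  induction h : ∑ i, J i generalizing J with
  | zero =>
    have : J = 0 := funext fun i => by simpa using Finset.sum_eq_zero_iff.1 h i
    exact this ▸ zero
  | succ m ih =>
    obtain ⟨i, hi⟩ : ∃ i, J i ≠ 0 := by
      by_contra! h'
      simp [h'] at h
    -- Truncated subtraction is exact here because `J i ≠ 0`.
    have hJ : J - Pi.single i 1 + Pi.single i 1 = J := by
      ext k
      by_cases hk : k = i
      · subst hk
        simpa using Nat.sub_add_cancel (Nat.pos_of_ne_zero hi)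
      · simp [hk]
    rw [← hJ]
    refine add_single _ i (ih _ ?_)
    rw [← hJ] at h
    simpa [Finset.sum_add_distrib] using h

theorem sum_add_single (J : Fin n → ℕ) (i : Fin n) :
    ∑ k, (J + Pi.single i 1 : Fin n → ℕ) k = ∑ k, J k + 1 := by
  simp [Finset.sum_add_distrib]

/-! ### Linearization, its adjoint, and the Euler operator. -/

/-- The map `f ↦ f'(P)`. -/
noncomputable def linearization (P : A) : A →ₗ[ℝ] A :=
  jetSum fun J => LinearMap.mulRight ℝ (totDIter J P)

/-- The map `f ↦ f'^*(Q)`. -/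
noncomputable def adjLinearization (Q : A) : A →ₗ[ℝ] A :=
  jetSum fun J => (-1 : ℝ) ^ (∑ i, J i) • (totDIter J ∘ₗ LinearMap.mulRight ℝ Q)

variable (A) in
/-- The Euler--Lagrange operator. -/
noncomputable def euler : A →ₗ[ℝ] A :=
  jetSum fun J => (-1 : ℝ) ^ (∑ i, J i) • totDIter J

theorem linearization_apply (P : A) {a : A} {S : Finset (Fin n → ℕ)} (hS : dSupp a ⊆ S) :
    linearization P a = ∑ J ∈ S, dU J a * totDIter J P := jetSum_apply _ hS

theorem adjLinearization_apply (Q : A) {a : A} {S : Finset (Fin n → ℕ)} (hS : dSupp a ⊆ S) :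
    adjLinearization Q a = ∑ J ∈ S, (-1 : ℝ) ^ (∑ i, J i) • totDIter J (dU J a * Q) :=
  jetSum_apply _ hS

theorem euler_apply {a : A} {S : Finset (Fin n → ℕ)} (hS : dSupp a ⊆ S) :
    euler A a = ∑ J ∈ S, (-1 : ℝ) ^ (∑ i, J i) • totDIter J (dU J a) := jetSum_apply _ hS

/-- A prolonged evolutionary vector field commutes with `D_i`: the two sums of `jetSum_totD` are the
two Leibniz terms of `D_i (a_J D_J P)`. -/
theorem linearization_totD (P : A) (i : Fin n) (a : A) :
    linearization P (totD i a) = totD i (linearization P a) := by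
  rw [linearization, jetSum_totD, jetSum_apply _ (subset_refl (dSupp a)),
    jetSum_apply _ (subset_refl (dSupp a)), jetSum_apply _ (subset_refl (dSupp a)), map_sum,
    ← Finset.sum_add_distrib]
  refine Finset.sum_congr rfl fun J _ => ?_
  simp only [LinearMap.comp_apply, LinearMap.mulRight_apply, Derivation.coeFn_coe,
    Derivation.leibniz, smul_eq_mul, totDIter_add_single]
  ring

theorem linearization_totDIter (P : A) (J : Fin n → ℕ) (a : A) :
    linearization P (totDIter J a) = totDIter J (linearization P a) := by
  induction J using multiIndex_induction with
  | zero => simp only [totDIter_zero]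
  | add_single J i ih => rw [totDIter_add_single, linearization_totD, ih, totDIter_add_single]

/-- Adjoint form of `(D_i a)' = D_i ∘ a'`. The shifted sum carries the sign `(-1)^(|J|+1)`; it
cancels the terms where `D_i` hits `∂a/∂u_J` and leaves those where it hits `Q`. -/
theorem adjLinearization_totD (Q : A) (i : Fin n) (a : A) :
    adjLinearization Q (totD i a) = -adjLinearization (totD i Q) a := by
  rw [adjLinearization, jetSum_totD, adjLinearization_apply _ (subset_refl (dSupp a)),
    jetSum_apply _ (subset_refl (dSupp a)), jetSum_apply _ (subset_refl (dSupp a)),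
    ← Finset.sum_add_distrib, ← Finset.sum_neg_distrib]
  refine Finset.sum_congr rfl fun J _ => ?_
  simp only [LinearMap.comp_apply, LinearMap.mulRight_apply, Derivation.coeFn_coe,
    LinearMap.smul_apply, sum_add_single, totDIter_add_single]
  rw [← totDIter_totD, Derivation.leibniz, map_add, pow_succ, mul_neg_one, smul_eq_mul,
    smul_eq_mul, mul_comm Q]
  simp only [neg_smul, smul_add]
  abel

theorem adjLinearization_totDIter (Q : A) (J : Fin n → ℕ) (a : A) :
    adjLinearization Q (totDIter J a) =
      (-1 : ℝ) ^ (∑ i, J i) • adjLinearization (totDIter J Q) a := by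
  induction J using multiIndex_induction generalizing Q with
  | zero => simp [totDIter_zero]
  | add_single J i ih =>
    rw [totDIter_add_single, adjLinearization_totD, ih, sum_add_single, totDIter_add_single,
      totDIter_totD, pow_succ, mul_neg_one, neg_smul]

/-- The linearization of an Euler--Lagrange expression is formally self-adjoint. -/
theorem linearization_euler (P L : A) :
    linearization P (euler A L) = adjLinearization P (euler A L) := by
  have hl : ∀ J, linearization P (dU J L) = ∑ K ∈ dSupp L, dU K (dU J L) * totDIter K P :=
    fun J => linearization_apply P (dSupp_dU_subset L J)
  have ha : ∀ J Q, adjLinearization Q (dU J L) =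
      ∑ K ∈ dSupp L, (-1 : ℝ) ^ (∑ i, K i) • totDIter K (dU K (dU J L) * Q) :=
    fun J Q => adjLinearization_apply Q (dSupp_dU_subset L J)
  have hsq : ∀ m : ℕ, (-1 : ℝ) ^ m * (-1) ^ m = 1 := fun m => by
    rw [← mul_pow]; simp
  -- The left side becomes `∑_J ∑_K (-1)^|J| D_J (L_{JK} D_K P)`. On the right the two signs in `J`
  -- cancel, giving `∑_J ∑_K (-1)^|K| D_K (L_{KJ} D_J P)`. These agree after exchanging `J` and `K`,
  -- as `L_{JK} = L_{KJ}`.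
  simp only [euler_apply (subset_refl (dSupp L)), map_sum, map_smul, linearization_totDIter,
    adjLinearization_totDIter, hl, ha, smul_smul, hsq, one_smul]
  simp only [Finset.smul_sum]
  rw [Finset.sum_comm]
  simp only [dU_dU_comm]

theorem linearization_mul (P a b : A) :
    linearization P (a * b) = a * linearization P b + b * linearization P a := by
  rw [linearization, jetSum_mul, jetSum_apply _ (subset_refl (dSupp a)),
    jetSum_apply _ (subset_refl (dSupp b)), jetSum_apply _ (subset_refl (dSupp a)),
    jetSum_apply _ (subset_refl (dSupp b)), Finset.mul_sum, Finset.mul_sum]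
  simp only [LinearMap.comp_apply, LinearMap.mulLeft_apply, LinearMap.mulRight_apply, mul_assoc]

theorem adjLinearization_mul (Q a b : A) :
    adjLinearization Q (a * b) = adjLinearization (a * Q) b + adjLinearization (b * Q) a := by
  have h : ∀ c : A, LinearMap.mulRight ℝ Q ∘ₗ LinearMap.mulLeft ℝ c =
      LinearMap.mulRight ℝ (c * Q) := fun c => LinearMap.ext fun x => by
    simp only [LinearMap.comp_apply, LinearMap.mulLeft_apply, LinearMap.mulRight_apply]; ring
  rw [adjLinearization, jetSum_mul]
  simp only [LinearMap.smul_comp, LinearMap.comp_assoc, h]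
  rfl

/-! ### Vanishing at formal solutions. -/

/-- The differential consequences of `g` form a differential ideal. -/
theorem map_totDIter_mul_eq_zero {φ : A →+* ℝ} {g : A} (hg : ∀ J, φ (totDIter J g) = 0) (h : A)
    (J : Fin n → ℕ) : φ (totDIter J (g * h)) = 0 := by
  -- Leibniz produces `g D_i h` and `h D_i g`, so the hypothesis is needed also for `D_i g`, whose
  -- total derivatives vanish as well.
  induction J using multiIndex_induction generalizing g h with
  | zero => rw [totDIter_zero, map_mul, ← totDIter_zero g, hg, zero_mul]
  | add_single J i ih =>
    rw [totDIter_add_single, ← totDIter_totD, Derivation.leibniz, map_add, map_add, smul_eq_mul,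
      smul_eq_mul, mul_comm h, ih hg, ih (fun K => ?_), zero_add]
    rw [totDIter_totD, ← totDIter_add_single, hg]

theorem map_adjLinearization_eq_zero (φ : A →ₐ[ℝ] ℝ) {g : A} (hg : ∀ J, φ (totDIter J g) = 0)
    (h a : A) : φ (adjLinearization (g * h) a) = 0 := by
  rw [adjLinearization_apply _ subset_rfl, map_sum]
  refine Finset.sum_eq_zero fun J _ => ?_
  rw [map_smul, mul_left_comm]
  exact smul_eq_zero_of_right _ (map_totDIter_mul_eq_zero (φ := φ.toRingHom) hg _ J)

/-- If `w g` is an Euler--Lagrange expression, multiplication by `w` maps solutions of the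
linearized equation to solutions of the adjoint linearized equation, on the solutions of `g = 0`. -/
theorem map_adjLinearization_mul_eq_zero (φ : A →ₐ[ℝ] ℝ) {g w L : A} (hL : euler A L = w * g)
    (hg : ∀ J, φ (totDIter J g) = 0) {P : A} (hP : φ (linearization P g) = 0) :
    φ (adjLinearization (w * P) g) = 0 := by
  -- After the product rules, every term except `adjLinearization (w * P) g` vanishes under `φ`.
  have h := congrArg φ (linearization_euler P L)
  rw [hL, linearization_mul, adjLinearization_mul, map_add, map_add, map_mul, map_mul, hP,
    map_adjLinearization_eq_zero φ hg, ← totDIter_zero g, hg] at h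
  simpa [totDIter_zero] using h.symm

end JetAlgebra

open JetAlgebra

/-! ### Differential functions on `U` as a jet algebra. -/

section DiffAlg

/-- The algebra of differential functions on an open set `U` of jet space, as functions on `U`. -/
def diffAlg {n : ℕ} (U : Opens (Jet n)) : Subalgebra ℝ (U → ℝ) where
  carrier := {a | ∃ f, IsDifferentialFunction (U : Set (Jet n)) f ∧ ∀ z : U, f z = a z}
  mul_mem' := by
    rintro a b ⟨f, hf, hfa⟩ ⟨g, hg, hgb⟩
    exact ⟨f * g, hf.mul hg, fun z => by simp [hfa z, hgb z]⟩
  add_mem' := by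
    rintro a b ⟨f, hf, hfa⟩ ⟨g, hg, hgb⟩
    exact ⟨f + g, hf.add hg, fun z => by simp [hfa z, hgb z]⟩
  algebraMap_mem' c := ⟨_, .const _ c, fun _ => rfl⟩

variable {n : ℕ} {U : Opens (Jet n)}

/-- The function `f` on jet space restricts to the element `a` of the algebra of differential
functions on `U`. -/
def Restricts (f : Jet n → ℝ) (a : diffAlg U) : Prop := ∀ z : U, f z = (a : U → ℝ) z

theorem IsDifferentialFunction.exists_restricts {f : Jet n → ℝ}
    (hf : IsDifferentialFunction (U : Set (Jet n)) f) : ∃ a : diffAlg U, Restricts f a :=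
  ⟨⟨fun z => f z, f, hf, fun _ => rfl⟩, fun _ => rfl⟩

theorem Restricts.isDifferentialFunction {f : Jet n → ℝ} {a : diffAlg U} (h : Restricts f a) :
    IsDifferentialFunction (U : Set (Jet n)) f := by
  obtain ⟨a, g, hg, hga⟩ := a
  exact hg.congr fun z hz => (h ⟨z, hz⟩).trans (hga ⟨z, hz⟩).symm

theorem Restricts.mul {f g : Jet n → ℝ} {a b : diffAlg U} (hf : Restricts f a)
    (hg : Restricts g b) : Restricts (f * g) (a * b) := fun z => by
  simp [hf z, hg z]

theorem Restricts.add {f g : Jet n → ℝ} {a b : diffAlg U} (hf : Restricts f a)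
    (hg : Restricts g b) : Restricts (f + g) (a + b) := fun z => by
  simp [hf z, hg z]

theorem Restricts.unique {f : Jet n → ℝ} {a b : diffAlg U} (ha : Restricts f a)
    (hb : Restricts f b) : a = b :=
  Subtype.ext (funext fun z => (ha z).symm.trans (hb z))

/-- A function on jet space that restricts to a given differential function on `U`. -/
noncomputable def extendJet (a : diffAlg U) : Jet n → ℝ := a.2.choose

theorem restricts_extendJet (a : diffAlg U) : Restricts (extendJet a) a := a.2.choose_spec.2

theorem Restricts.lineDeriv_eq {f g : Jet n → ℝ} {a : diffAlg U} (hf : Restricts f a)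
    (hg : Restricts g a) (w : Jet n) (z : U) : lineDeriv ℝ f z w = lineDeriv ℝ g z w :=
  lineDeriv_congr_of_eqOn U.isOpen (fun y hy => (hf ⟨y, hy⟩).trans (hg ⟨y, hy⟩).symm) w z.2

/-- The derivative in a constant direction `w`, as a derivation of the algebra of differential
functions. -/
noncomputable def dirD (w : Jet n) : Derivation ℝ (diffAlg U) (diffAlg U) :=
  Derivation.mk'
    { toFun := fun a => ⟨fun z => lineDeriv ℝ (extendJet a) z w, _,
        ((restricts_extendJet a).isDifferentialFunction.dirDeriv U.isOpen w), fun _ => rfl⟩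
      map_add' := fun a b => Subtype.ext <| funext fun z => by
        have h : Restricts ((extendJet a) + (extendJet b)) (a + b) := fun z => by
          simp [(restricts_extendJet a) z, (restricts_extendJet b) z]
        have ha := (restricts_extendJet a).isDifferentialFunction.lineDifferentiableAt U.isOpen w z.2
        have hb := (restricts_extendJet b).isDifferentialFunction.lineDifferentiableAt U.isOpen w z.2
        exact ((restricts_extendJet (a + b)).lineDeriv_eq h w z).trans (deriv_add ha hb)
      map_smul' := fun c a => Subtype.ext <| funext fun z => by
        have h : Restricts (c • (extendJet a)) (c • a) := fun z => by
          simp [(restricts_extendJet a) z]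
        have ha := (restricts_extendJet a).isDifferentialFunction.lineDifferentiableAt U.isOpen w z.2
        exact ((restricts_extendJet (c • a)).lineDeriv_eq h w z).trans (deriv_const_smul c ha) }
    fun a b => Subtype.ext <| funext fun z => by
      have h := (restricts_extendJet a).mul (restricts_extendJet b)
      have ha := (restricts_extendJet a).isDifferentialFunction.lineDifferentiableAt U.isOpen w z.2
      have hb := (restricts_extendJet b).isDifferentialFunction.lineDifferentiableAt U.isOpen w z.2
      refine (((restricts_extendJet (a * b)).lineDeriv_eq h w z).trans (deriv_mul ha hb)).trans ?_
      simp [(restricts_extendJet a) z, (restricts_extendJet b) z, lineDeriv]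
      ring

/-- The arbitrary extension chosen in `dirD` is immaterial: `U` is open and derivatives are local.
-/
theorem Restricts.dirD {f : Jet n → ℝ} {a : diffAlg U} (h : Restricts f a) (w : Jet n) :
    Restricts (fun z => lineDeriv ℝ f z w) (dirD w a) :=
  fun z => h.lineDeriv_eq (restricts_extendJet a) w z

theorem dirD_comm (v w : Jet n) (a : diffAlg U) : dirD v (dirD w a) = dirD w (dirD v a) := by
  have h := (restricts_extendJet a)
  refine Subtype.ext (funext fun z => ?_)
  rw [← (h.dirD w).dirD v z, ← (h.dirD v).dirD w z]
  exact h.isDifferentialFunction.lineDeriv_comm U.isOpen w v z.2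

theorem finite_dirD_ne_zero (a : diffAlg U) :
    {J | dirD ((0, Pi.single J 1) : Jet n) a ≠ 0}.Finite := by
  obtain ⟨a, f, ⟨S, F, hF, hf⟩, ha⟩ := a
  refine S.finite_toSet.subset fun J hJ => ?_
  by_contra hJS
  refine hJ (Subtype.ext (funext fun z => ?_))
  have h : Restricts f (⟨a, f, ⟨S, F, hF, hf⟩, ha⟩ : diffAlg U) := ha
  -- A direction `u_J` with `J ∉ S` is invisible to the representative.
  have hw : jetProj S ((0, Pi.single J 1) : Jet n) = 0 := by
    ext K
    · rfl
    · have : (K : Fin n → ℕ) ≠ J := fun h => hJS (h ▸ K.2)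
      simp [jetProj, this]
  refine (h.dirD _ z).symm.trans ?_
  beta_reduce
  rw [(hasLineDerivAt_of_representative U.isOpen hF hf _ z.2).lineDeriv, hw]
  simp

/-- The coordinate `u_J` as a differential function on `U`. -/
def coordU (J : Fin n → ℕ) : diffAlg U := ⟨fun z => z.1.2 J, _, .coordU _ J, fun _ => rfl⟩

theorem dirD_coordU (w : Jet n) (J : Fin n → ℕ) :
    dirD w (coordU J : diffAlg U) = algebraMap ℝ (diffAlg U) (w.2 J) := by
  have h : Restricts (fun z : Jet n => z.2 J) (coordU J : diffAlg U) := fun z => rfl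
  refine Subtype.ext (funext fun z => ?_)
  rw [← h.dirD w z]
  have : HasDerivAt (fun t : ℝ => z.1.2 J + t * w.2 J) (1 * w.2 J) 0 :=
    ((hasDerivAt_id (0 : ℝ)).mul_const (w.2 J)).const_add _
  rw [one_mul] at this
  exact this.deriv

noncomputable instance : JetAlgebra n (diffAlg U) where
  dX i := dirD (Pi.single i 1, 0)
  dU J := dirD (0, Pi.single J 1)
  uCoord := coordU
  dX_dX_comm _ _ := dirD_comm _ _
  dU_dX_comm _ _ := dirD_comm _ _
  dU_dU_comm _ _ := dirD_comm _ _
  finite_dU_ne_zero := finite_dirD_ne_zero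
  dX_uCoord i J := by simp [dirD_coordU]
  dU_uCoord K J := by
    rw [dirD_coordU]
    by_cases h : K = J
    · simp [h]
    · simp [h, Ne.symm h]

/-! ### Transfer of the operators from functions to the algebra. -/

theorem restricts_uCoord (J : Fin n → ℕ) : Restricts (fun z => z.2 J) (uCoord J : diffAlg U) :=
  fun _ => rfl

theorem Restricts.partialX {f : Jet n → ℝ} {a : diffAlg U} (h : Restricts f a) (i : Fin n) :
    Restricts (partialX i f) (dX i a) := fun z =>
  (partialX_eq_lineDeriv i f z).trans (h.dirD _ z)

theorem Restricts.partialU {f : Jet n → ℝ} {a : diffAlg U} (h : Restricts f a)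
    (J : Fin n → ℕ) : Restricts (partialU J f) (dU J a) := fun z =>
  (partialU_eq_lineDeriv J f z).trans (h.dirD _ z)

/-- At each point the support of the summands lies in `dSupp a`, so the pointwise and the algebraic
sums agree. This serves every operator defined by a sum over `J`. -/
theorem Restricts.finsum {Φ : (Fin n → ℕ) → diffAlg U →ₗ[ℝ] diffAlg U} {a : diffAlg U}
    {g : (Fin n → ℕ) → Jet n → ℝ} (h : ∀ J, Restricts (g J) (Φ J (dU J a))) :
    Restricts (fun z => ∑ᶠ J, g J z) (jetSum Φ a) := fun z => by
  have hz : ∀ J, g J z = (Φ J (dU J a) : U → ℝ) z := fun J => h J z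
  simp only [hz]
  rw [jetSum_apply Φ subset_rfl, finsum_eq_sum_of_support_subset (s := dSupp a)]
  · simp
  · intro J hJ
    by_contra h
    exact hJ (by simp [dU_eq_zero h])

theorem Restricts.totalD {f : Jet n → ℝ} {a : diffAlg U} (h : Restricts f a) (i : Fin n) :
    Restricts (totalD i f) (totD i a) := by
  have hJ : ∀ J : Fin n → ℕ, Restricts ((fun z => z.2 (J + Pi.single i 1)) * _root_.partialU J f)
      (LinearMap.mulLeft ℝ (uCoord (J + Pi.single i 1) : diffAlg U) (dU J a)) := fun J => by
    rw [LinearMap.mulLeft_apply]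
    exact (restricts_uCoord _).mul (h.partialU J)
  have hs := Restricts.finsum hJ
  rw [totD_eq]
  exact (h.partialX i).add hs

theorem Restricts.totalDIter {f : Jet n → ℝ} {a : diffAlg U} (h : Restricts f a)
    (J : Fin n → ℕ) : Restricts (totalDIter J f) (totDIter J a) := by
  have iter : ∀ (i : Fin n) (m : ℕ) {g : Jet n → ℝ} {b : diffAlg U}, Restricts g b →
      Restricts ((_root_.totalD i)^[m] g)
        (((totD i).toLinearMap : Module.End ℝ (diffAlg U)) ^ m • b) := by
    intro i m g b hg
    induction m with
    | zero => simpa using hg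
    | succ m ih =>
      rw [Function.iterate_succ_apply', pow_succ', mul_smul]
      exact ih.totalD i
  unfold _root_.totalDIter totDIter
  induction List.finRange n with
  | nil => exact h
  | cons i l ih =>
    rw [List.foldr_cons, List.map_cons, List.prod_cons, Module.End.mul_apply]
    exact iter i (J i) ih

theorem Restricts.frechet {f P : Jet n → ℝ} {a p : diffAlg U} (hf : Restricts f a)
    (hP : Restricts P p) : Restricts (frechet f P) (linearization p a) :=
  Restricts.finsum fun J => (hf.partialU J).mul (hP.totalDIter J)

theorem Restricts.signed {f : Jet n → ℝ} {a : diffAlg U} (hf : Restricts f a) (m : ℕ) :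
    Restricts (fun z => (-1 : ℝ) ^ m * f z) ((-1 : ℝ) ^ m • a) := fun z =>
  congrArg ((-1 : ℝ) ^ m * ·) (hf z)

theorem Restricts.frechetAdjoint {f Q : Jet n → ℝ} {a q : diffAlg U} (hf : Restricts f a)
    (hQ : Restricts Q q) : Restricts (frechetAdjoint f Q) (adjLinearization q a) :=
  Restricts.finsum fun J => (((hf.partialU J).mul hQ).totalDIter J).signed _

theorem Restricts.eulerOperator {f : Jet n → ℝ} {a : diffAlg U} (hf : Restricts f a) :
    Restricts (eulerOperator f) (euler _ a) :=
  Restricts.finsum fun J => ((hf.partialU J).totalDIter J).signed _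

/-- Evaluation of differential functions at a point of `U`. -/
def evalAt (z : U) : diffAlg U →ₐ[ℝ] ℝ := (Pi.evalAlgHom ℝ (fun _ : U => ℝ) z).comp (diffAlg U).val

theorem evalAt_totDIter_eq_zero {G : Jet n → ℝ} {g : diffAlg U} (hg : Restricts G g) {z : Jet n}
    (hz : z ∈ formalSolutions (U : Set (Jet n)) G) (J : Fin n → ℕ) :
    evalAt ⟨z, hz.1⟩ (totDIter J g) = 0 :=
  (hg.totalDIter J ⟨z, hz.1⟩).symm.trans (hz.2 J)

/-! ### Symmetries and adjoint-symmetries. -/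

/-- On an Euler--Lagrange equation, linearization and adjoint linearization agree. -/
theorem IsEulerLagrange.frechet_eq_frechetAdjoint {G P : Jet n → ℝ}
    (h : IsEulerLagrange (U : Set (Jet n)) G)
    (hP : IsDifferentialFunction (U : Set (Jet n)) P) (z : U) :
    frechet G P z = frechetAdjoint G P z := by
  obtain ⟨L, hL, hLG⟩ := h
  obtain ⟨L', hL'⟩ := hL.exists_restricts
  obtain ⟨p, hp⟩ := hP.exists_restricts
  have hG : Restricts G (euler _ L') := fun z => (hLG z z.2).symm.trans (hL'.eulerOperator z)
  rw [hG.frechet hp z, hG.frechetAdjoint hp z, linearization_euler]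

theorem IsVariationalIntegratingFactor.isAdjointSymmetry_mul {G W P : Jet n → ℝ}
    (hG : IsDifferentialFunction (U : Set (Jet n)) G)
    (hW : IsVariationalIntegratingFactor (U : Set (Jet n)) G W)
    (hP : IsSymmetry (U : Set (Jet n)) G P) :
    IsAdjointSymmetry (U : Set (Jet n)) G (W * P) := by
  obtain ⟨hWd, -, L, hL, hLW⟩ := hW
  obtain ⟨g, hg⟩ := hG.exists_restricts
  obtain ⟨w, hw⟩ := hWd.exists_restricts
  obtain ⟨p, hp⟩ := hP.1.exists_restricts
  obtain ⟨L', hL'⟩ := hL.exists_restricts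
  refine ⟨hWd.mul hP.1, fun z hz => ?_⟩
  have hE : euler _ L' = w * g :=
    hL'.eulerOperator.unique fun z => (hLW z z.2).trans (hw.mul hg z)
  exact (hg.frechetAdjoint (hw.mul hp) ⟨z, hz.1⟩).trans <|
    map_adjLinearization_mul_eq_zero (evalAt ⟨z, hz.1⟩) hE (evalAt_totDIter_eq_zero hg hz) <|
      (hg.frechet hp ⟨z, hz.1⟩).symm.trans (hP.2 z hz)

theorem IsVariationalIntegratingFactor.isSymmetry_mul {G W P : Jet n → ℝ}
    (hG : IsDifferentialFunction (U : Set (Jet n)) G)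
    (hW : IsVariationalIntegratingFactor (U : Set (Jet n)) G W)
    (hEL : IsEulerLagrange (U : Set (Jet n)) G)
    (hP : IsSymmetry (U : Set (Jet n)) G P) : IsSymmetry (U : Set (Jet n)) G (W * P) := by
  obtain ⟨hd, h⟩ := hW.isAdjointSymmetry_mul hG hP
  exact ⟨hd, fun z hz => (hEL.frechet_eq_frechetAdjoint hd ⟨z, hz.1⟩).trans (h z hz)⟩

theorem totalDIter_zero (P : Jet n → ℝ) : totalDIter 0 P = P := by
  unfold totalDIter
  induction List.finRange n with
  | nil => rfl
  | cons i l ih => exact ih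

end DiffAlg

theorem proposition3p1 (n : ℕ) (U : Set (Jet n)) (hU : IsOpen U) (G W : Jet n → ℝ)
    (hG : IsDifferentialFunction U G) (hW : IsVariationalIntegratingFactor U G W) :
    (∀ P : Jet n → ℝ, IsSymmetry U G P → IsAdjointSymmetry U G (W * P)) ∧
    (IsEulerLagrange U G →
      (∀ P : Jet n → ℝ, IsSymmetry U G P → ∀ l : ℕ, IsSymmetry U G (W ^ l * P)) ∧
      IsRecursionOperator U G (fun P => W * P)) := by
  lift U to Opens (Jet n) using hU
  refine ⟨fun P hP => hW.isAdjointSymmetry_mul hG hP, fun hEL => ⟨fun P hP l => ?_, ?_, ?_⟩⟩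
  · induction l with
    | zero => simpa using hP
    | succ l ih =>
      rw [pow_succ', mul_assoc]
      exact hW.isSymmetry_mul hG hEL ih
  -- Order zero: the only term is `J = 0`, with coefficient `W`, and `D_0` is the identity.
  · refine ⟨{0}, fun _ => W, fun _ _ => hW.1, fun P _ z _ => ?_⟩
    rw [Finset.sum_singleton, totalDIter_zero]
    rfl
  · exact fun P hP => hW.isSymmetry_mul hG hEL hP
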